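/- **Setting.** Let $f,g,\varphi_1,\dots,\varphi_s\in\mathbb R[x]$, $x=(x_1,\dots,x_m)$, let $p\in\mathbb R[x,y]$, $y=(y_1,\dots,y_n)$, and $\mathbf Y\subseteq\mathbb R^n$. Put $$\mathbf K=\{x\in\mathbb R^m:\varphi_j(x)\le 0\ (j=1,\dots,s),\ p(x,y)\le 0\ \ \forall y\in\mathbf Y\},\qquad r^\star=\inf_{x\in\mathbf K}\frac{f(x)}{g(x)},$$ and let $\mathbf S$ be the set of minimizers of $f/g$ on $\mathbf K$. A polynomial $h\in\mathbb R[x]$ is *s.o.s-convex* if $\nabla^2h=H^TH$ for some $r\times m$ matrix $H$ of polynomials. Assume: * **A1**: $\mathbf Y\subseteq[-1,1]^n$ is closed; all $\varphi_j$ and all $p(\cdot,y)$, $y\in\mathbf Y$, are s.o.s-convex. * **A2**: $f$ and $-g$ are s.o.s-convex; either $f>0$ and $g>0$ on $\mathbf K$, or $g$ is affine and $g>0$ on $\mathbf K$. * **A3** (Slater): there is $u\in\mathbf K$ with $p(u,y)<0$ for all $y\in\mathbf Y$ and $\varphi_j(u)<0$ for all $j$. Fix $\mathfrak R>0$ and $g^\star>0$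 such that some $u^\star\in\mathbf S$ satisfies $\|u^\star\|<\mathfrak R$ (Euclidean norm) and $g(u^\star)>g^\star$; in particular $\mathbf S\ne\emptyset$. Let $\mathbf d=\lceil\max\{\deg f,\deg g,\deg\varphi_1,\dots,\deg\varphi_s,\deg_x p\}/2\rceil$ and $d_y=\deg_y p$. Write $\mathbb R[\cdot]_t$ for the polynomials of degree at most $t$ and $\Sigma^2[\cdot]$ for sums of squares of polynomials. Let $q_0=1$, $q_1=\mathfrak R^2-\|x\|^2$, $q_2=g-g^\star$, $$\mathbf M=\Big\{\sum_{j=0}^2\sigma_jq_j:\ \sigma_j\in\Sigma^2[x],\ \deg(\sigma_jq_j)\le 2\mathbf d,\ j=0,1,2\Big\},$$ and for $k\in\mathbb N$ let $$\mathcal P^k=\Big\{\psi\in\mathbb R[y]_{d_y}:\ \int_{\mathbf Y}\psi\sigma\,dy\ge 0\ \ \forall\sigma\in\Sigma^2[y]\cap\mathbb R[y]_{2k}\Big\}.$$ Linear functionals $\mathscr L$ on $\mathbb R[x]_{2\mathbf d}$ and $\mathscr H$ on $\mathbb R[y]_{d_y}$ act on $p(x,y)$ in the variables $x$, resp. $y$,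 so that $\mathscr L(p)\in\mathbb R[y]$ and $\mathscr H(p)\in\mathbb R[x]$. Consider, with values in $[-\infty,\infty]$, $$(P_k)\quad r_k^{\rm primal}=\sup\Big\{\rho:\ f-\rho g+\mathscr H(p)+\sum_{j=1}^s\eta_j\varphi_j\in\mathbf M,\ \rho\in\mathbb R,\ \mathscr H\in(\mathbb R[y]_{d_y})^*,\ \mathscr H\ge 0\text{ on }\mathcal P^k,\ \eta\in\mathbb R_+^s\Big\},$$ $$(D_k)\quad r_k^{\rm dual}=\inf\Big\{\mathscr L(f):\ \mathscr L\in(\mathbb R[x]_{2\mathbf d})^*,\ \mathscr L\ge0\text{ on }\mathbf M,\ \mathscr L(g)=1,\ -\mathscr L(p)\in\mathcal P^k,\ \mathscr L(\varphi_j)\le 0\ \forall j\Big\}.$$ For $\mathbf d\ge 1$ let $\mathscr L(x)=(\mathscr L(x_1),\dots,\mathscr L(x_m))$. Say that $\mathbf Y$ has *full support* if every neighbourhood of every point of $\mathbf Y$ meets $\mathbf Y$ in a set of positive Lebesgue measure. **Theorem.** 1. For every $k\in\mathbb N$, $r_k^{\rm primal}=r_k^{\rm dual}\le r^\star$, and $(D_k)$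 has a minimizer. 2. If $\mathbf Y$ has full support, then $\lim_{k\to\infty}r_k^{\rm primal}=\lim_{k\to\infty}r_k^{\rm dual}=r^\star$. 3. Let $\mathbf d\ge1$ and let $\mathscr L_k^\star$ be a minimizer of $(D_k)$ for each $k$. Then $\mathscr L_k^\star(1)>0$ for all $k$, and the sequence $\mathscr L_k^\star(x)/\mathscr L_k^\star(1)$ has a convergent subsequence. If $\mathbf Y$ has full support, the limit of every convergent subsequence lies in $\mathbf S$; consequently, if $\mathbf S=\{u\}$, then $\lim_{k\to\infty}\mathscr L_k^\star(x)/\mathscr L_k^\star(1)=u$. -/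

import Mathlib

open MvPolynomial MeasureTheory

/-- A real polynomial `h` is s.o.s-convex if its Hessian matrix factors as `Hᵀ * H` for some
`r × m` matrix `H` of polynomials. -/
def IsSOSConvex {m : ℕ} (h : MvPolynomial (Fin m) ℝ) : Prop :=
  ∃ (r : ℕ) (H : Matrix (Fin r) (Fin m) (MvPolynomial (Fin m) ℝ)),
    (Matrix.of fun i j => pderiv i (pderiv j h)) = H.transpose * H

/-- The polynomial data of the fractional semi-infinite program
`min f(x)/g(x)` subject to `φ₁(x) ≤ 0, …, φₛ(x) ≤ 0` and `p(x,y) ≤ 0` for all `y ∈ Y`.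
The polynomial `p ∈ ℝ[x,y]` is regarded as a polynomial in `x` with coefficients in `ℝ[y]`. -/
structure FSIPP (m n s : ℕ) where
  f : MvPolynomial (Fin m) ℝ
  g : MvPolynomial (Fin m) ℝ
  φ : Fin s → MvPolynomial (Fin m) ℝ
  p : MvPolynomial (Fin m) (MvPolynomial (Fin n) ℝ)
  Y : Set (Fin n → ℝ)

namespace FSIPP

variable {m n s : ℕ} (P : FSIPP m n s)

/-- The polynomial `p(·, y) ∈ ℝ[x]`. -/
noncomputable def pAt (y : Fin n → ℝ) : MvPolynomial (Fin m) ℝ :=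
  MvPolynomial.map (MvPolynomial.eval y) P.p

/-- The feasible set `K`. -/
def feasibleSet : Set (Fin m → ℝ) :=
  {x | (∀ j, eval x (P.φ j) ≤ 0) ∧ ∀ y ∈ P.Y, eval x (P.pAt y) ≤ 0}

/-- The objective function `f(x)/g(x)`. -/
noncomputable def ratio (x : Fin m → ℝ) : ℝ := eval x P.f / eval x P.g

/-- The set `S` of optimal solutions. -/
def solutionSet : Set (Fin m → ℝ) :=
  {u | u ∈ P.feasibleSet ∧ ∀ x ∈ P.feasibleSet, P.ratio u ≤ P.ratio x}

/-- The optimal value `r⋆` (a minimum as soon as the solution set is nonempty). -/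
noncomputable def optVal : ℝ := sInf (P.ratio '' P.feasibleSet)

/-- Assumption A1: `Y ⊆ [-1,1]ⁿ` is closed, and all `φⱼ` and all `p(·,y)`, `y ∈ Y`, are
s.o.s-convex. -/
structure A1 : Prop where
  subset_cube : P.Y ⊆ Set.Icc (fun _ => -1) (fun _ => 1)
  isClosed : IsClosed P.Y
  sosConvex_φ : ∀ j, IsSOSConvex (P.φ j)
  sosConvex_p : ∀ y ∈ P.Y, IsSOSConvex (P.pAt y)

/-- Assumption A2: `f` and `-g` are s.o.s-convex; either `f > 0` and `g > 0` on `K`, or `g` is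
affine and `g > 0` on `K`. -/
structure A2 : Prop where
  sosConvex_f : IsSOSConvex P.f
  sosConvex_neg_g : IsSOSConvex (-P.g)
  pos : (∀ x ∈ P.feasibleSet, 0 < eval x P.f ∧ 0 < eval x P.g) ∨
    (P.g.totalDegree ≤ 1 ∧ ∀ x ∈ P.feasibleSet, 0 < eval x P.g)

/-- Assumption A3: the Slater condition for `K`. -/
def A3 : Prop :=
  ∃ u ∈ P.feasibleSet, (∀ y ∈ P.Y, eval u (P.pAt y) < 0) ∧ ∀ j, eval u (P.φ j) < 0

/-- `d_y`, the degree of `p` in the variables `y`. -/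
noncomputable def degY : ℕ := P.p.support.sup fun α => (coeff α P.p).totalDegree

/-- The maximum of the degrees in `x` of `f`, `g`, `φ₁`, …, `φₛ` and `p`. -/
noncomputable def maxDeg : ℕ :=
  max (max P.f.totalDegree P.g.totalDegree)
    (max (Finset.univ.sup fun j => (P.φ j).totalDegree) P.p.totalDegree)

/-- `d = ⌈maxDeg / 2⌉`. -/
noncomputable def d : ℕ := (P.maxDeg + 1) / 2

/-- `ℝ[x]_{2d}`. -/
noncomputable abbrev PolyX : Submodule ℝ (MvPolynomial (Fin m) ℝ) :=
  restrictTotalDegree (Fin m) ℝ (2 * P.d)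

/-- `ℝ[y]_{d_y}`. -/
noncomputable abbrev PolyY : Submodule ℝ (MvPolynomial (Fin n) ℝ) :=
  restrictTotalDegree (Fin n) ℝ P.degY

theorem maxDeg_le : P.maxDeg ≤ 2 * P.d := by unfold d; omega

theorem f_mem : P.f ∈ P.PolyX :=
  (mem_restrictTotalDegree _ _ _).2
    (le_trans (le_trans (le_max_left _ _) (le_max_left _ _)) P.maxDeg_le)

theorem g_mem : P.g ∈ P.PolyX :=
  (mem_restrictTotalDegree _ _ _).2
    (le_trans (le_trans (le_max_right _ _) (le_max_left _ _)) P.maxDeg_le)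

theorem φ_mem (j : Fin s) : P.φ j ∈ P.PolyX :=
  (mem_restrictTotalDegree _ _ _).2
    (le_trans (Finset.le_sup (f := fun j => (P.φ j).totalDegree) (Finset.mem_univ j))
      (le_trans (le_trans (le_max_left _ _) (le_max_right _ _)) P.maxDeg_le))

theorem one_mem : (1 : MvPolynomial (Fin m) ℝ) ∈ P.PolyX :=
  (mem_restrictTotalDegree _ _ _).2 (by simp)

theorem X_mem (hd : 1 ≤ P.d) (i : Fin m) : (X i : MvPolynomial (Fin m) ℝ) ∈ P.PolyX :=
  (mem_restrictTotalDegree _ _ _).2 (by rw [totalDegree_X]; omega)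

theorem monomial_mem {α : Fin m →₀ ℕ} (hα : α ∈ P.p.support) :
    (monomial α 1 : MvPolynomial (Fin m) ℝ) ∈ P.PolyX := by
  refine (mem_restrictTotalDegree _ _ _).2 ?_
  rw [totalDegree_monomial _ one_ne_zero]
  exact le_trans (le_totalDegree hα)
    (le_trans (le_trans (le_max_right _ _) (le_max_right _ _)) P.maxDeg_le)

theorem coeff_mem (α : Fin m →₀ ℕ) : coeff α P.p ∈ P.PolyY := by
  refine (mem_restrictTotalDegree _ _ _).2 ?_
  by_cases hα : α ∈ P.p.support
  · exact Finset.le_sup (f := fun α => (coeff α P.p).totalDegree) hα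
  · rw [notMem_support_iff.1 hα]; simp

/-- `ℒ(p(x,y)) ∈ ℝ[y]`: the functional `ℒ` is applied to the monomials `x^α` of `p`. -/
noncomputable def applyX (L : Module.Dual ℝ P.PolyX) : MvPolynomial (Fin n) ℝ :=
  ∑ α ∈ P.p.support.attach, L ⟨monomial α.1 1, P.monomial_mem α.2⟩ • coeff α.1 P.p

/-- `ℋ(p(x,y)) ∈ ℝ[x]`: the functional `ℋ` is applied to the coefficients, in `ℝ[y]`, of `p`. -/
noncomputable def applyY (H : Module.Dual ℝ P.PolyY) : MvPolynomial (Fin m) ℝ :=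
  ∑ α ∈ P.p.support, monomial α (H ⟨coeff α P.p, P.coeff_mem α⟩)

/-- Lasserre's outer cone `P^k(Y)`: polynomials `ψ ∈ ℝ[y]_{d_y}` with `∫_Y ψ σ dy ≥ 0` for all
sums of squares `σ` of degree at most `2k`. -/
def outerCone (k : ℕ) : Set (MvPolynomial (Fin n) ℝ) :=
  {ψ | ψ.totalDegree ≤ P.degY ∧
    ∀ σ : MvPolynomial (Fin n) ℝ, IsSumSq σ → σ.totalDegree ≤ 2 * k →
      0 ≤ ∫ y in P.Y, eval y (ψ * σ)}

/-- The truncated quadratic module `M_d(Q)` generated by `q₁ = R² - ‖x‖²` and `q₂ = g - g⋆`. -/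
def quadModule (R gs : ℝ) : Set (MvPolynomial (Fin m) ℝ) :=
  {h | ∃ σ₀ σ₁ σ₂ : MvPolynomial (Fin m) ℝ,
    IsSumSq σ₀ ∧ IsSumSq σ₁ ∧ IsSumSq σ₂ ∧
    σ₀.totalDegree ≤ 2 * P.d ∧
    (σ₁ * (C (R ^ 2) - ∑ i, X i ^ 2)).totalDegree ≤ 2 * P.d ∧
    (σ₂ * (P.g - C gs)).totalDegree ≤ 2 * P.d ∧
    h = σ₀ + σ₁ * (C (R ^ 2) - ∑ i, X i ^ 2) + σ₂ * (P.g - C gs)}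

/-- Feasibility of `(ρ, ℋ, η)` in the primal relaxation `(P_k)`. -/
def PrimalFeasible (R gs : ℝ) (k : ℕ) (ρ : ℝ) (H : Module.Dual ℝ P.PolyY) (η : Fin s → ℝ) :
    Prop :=
  P.f - C ρ * P.g + P.applyY H + ∑ j, C (η j) * P.φ j ∈ P.quadModule R gs ∧
  (∀ ψ : P.PolyY, (ψ : MvPolynomial (Fin n) ℝ) ∈ P.outerCone k → 0 ≤ H ψ) ∧
  ∀ j, 0 ≤ η j

/-- Feasibility of `ℒ` in the dual relaxation `(D_k)`. -/
def DualFeasible (R gs : ℝ) (k : ℕ) (L : Module.Dual ℝ P.PolyX) : Prop :=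
  (∀ h : P.PolyX, (h : MvPolynomial (Fin m) ℝ) ∈ P.quadModule R gs → 0 ≤ L h) ∧
  L ⟨P.g, P.g_mem⟩ = 1 ∧
  -P.applyX L ∈ P.outerCone k ∧
  ∀ j, L ⟨P.φ j, P.φ_mem j⟩ ≤ 0

/-- The optimal value of `(P_k)`, a supremum in the extended reals. -/
noncomputable def primalVal (R gs : ℝ) (k : ℕ) : EReal :=
  sSup {r | ∃ ρ H η, P.PrimalFeasible R gs k ρ H η ∧ r = (ρ : EReal)}

/-- The optimal value of `(D_k)`, an infimum in the extended reals. -/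
noncomputable def dualVal (R gs : ℝ) (k : ℕ) : EReal :=
  sInf {r | ∃ L, P.DualFeasible R gs k L ∧ r = ((L ⟨P.f, P.f_mem⟩ : ℝ) : EReal)}

/-- `ℒ` is a minimizer of `(D_k)`. -/
def IsDualMinimizer (R gs : ℝ) (k : ℕ) (L : Module.Dual ℝ P.PolyX) : Prop :=
  P.DualFeasible R gs k L ∧
  ∀ L', P.DualFeasible R gs k L' → L ⟨P.f, P.f_mem⟩ ≤ L' ⟨P.f, P.f_mem⟩

/-- The normalized first moments `ℒ(x)/ℒ(1) ∈ ℝᵐ`. -/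
noncomputable def normMoment (hd : 1 ≤ P.d) (L : Module.Dual ℝ P.PolyX) : Fin m → ℝ :=
  fun i => L ⟨X i, P.X_mem hd i⟩ / L ⟨1, P.one_mem⟩

end FSIPP

/-!
The relaxation `(P_k)` maximizes `ρ` subject to `f - ρ g` lying in a convex cone of certificates
(`FSIPP.certCone`), and `ℒ` is feasible for `(D_k)` exactly when it is nonnegative on that cone and
`ℒ(g) = 1` (`FSIPP.dualFeasible_iff`). The proof rests on three facts.

*The constant `1` is an order unit.* Multiplying the ball constraint `R² - ‖x‖²` by squares of
monomials shows that the quadratic module already contains `N + h` for every `h` of degree at most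
`2d` and some `N` (`FSIPP.exists_C_add_mem_quadModule`). As `g = g⋆ + q₂`, so is `g`, and the M. Riesz
extension theorem gives strong duality together with a dual minimizer (`exists_dual_optimum`).
The same order unit bounds all dual feasible `ℒ` uniformly in `k` and forces `ℒ(1) > 0`.
Evaluation at `u⋆`, divided by `g(u⋆)`, is dual feasible, which bounds the values by `r⋆`.

*Jensen's inequality.* If `Λ` is nonnegative on sums of squares and `u = Λ(x)/Λ(1)`, then
`h(u) Λ(1) ≤ Λ(h)` for s.o.s-convex `h` (`IsSOSConvex.jensen`): the function
`t ↦ Λ(h(u + t(x - u)))` has nonnegative second derivative and vanishing derivative at `t = 0`.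

*Full support.* A polynomial `ψ` with `∫_Y ψ θ² ≥ 0` for all polynomials `θ` is nonnegative on `Y`
(`nonneg_of_integral_mul_sq_polynomial_nonneg`), by the Stone–Weierstrass theorem.

Along any ultrafilter finer than `atTop` dual minimizers converge pointwise to some `ℒ` that is
feasible for every `k`. By the last two facts its barycentre `ℒ(x)/ℒ(1)` is feasible for the original
problem and has ratio at most `ℒ(f) ≤ r⋆`, so it is a solution and `ℒ(f) = r⋆`
(`FSIPP.exists_mem_solutionSet_tendsto`).
-/

/-! ### Jensen's inequality for s.o.s-convex polynomials -/

/-- The restriction of polynomials to lines through `u`: the algebra homomorphism sending `h` to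
`h(u + T (x - u))`, a polynomial in `T` whose coefficients are polynomials in `x`. -/
noncomputable def lineHom {σ : Type*} (u : σ → ℝ) :
    MvPolynomial σ ℝ →ₐ[ℝ] Polynomial (MvPolynomial σ ℝ) :=
  aeval fun i => Polynomial.C (C (u i)) + Polynomial.X * Polynomial.C (X i - C (u i))

theorem lineHom_X {σ : Type*} (u : σ → ℝ) (i : σ) : lineHom u (X i) =
    Polynomial.C (C (u i)) + Polynomial.X * Polynomial.C (X i - C (u i)) := by
  simp [lineHom]

theorem lineHom_C {σ : Type*} (u : σ → ℝ) (a : ℝ) :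
    lineHom u (C a) = Polynomial.C (C a) := by
  rw [← MvPolynomial.algebraMap_eq, AlgHom.commutes]
  rfl

theorem derivative_lineHom {m : ℕ} (u : Fin m → ℝ) (h : MvPolynomial (Fin m) ℝ) :
    Polynomial.derivative (lineHom u h) =
      ∑ i, lineHom u (pderiv i h) * Polynomial.C (X i - C (u i)) := by
  induction h using MvPolynomial.induction_on with
  | C a => simp
  | add p q hp hq => simp [hp, hq, add_mul, Finset.sum_add_distrib]
  | mul_X p j hp =>
    rw [map_mul, Polynomial.derivative_mul, hp, lineHom_X]
    simp only [Derivation.leibniz, pderiv_X, smul_eq_mul, map_add, map_mul, lineHom_X, add_mul,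
      Finset.sum_add_distrib, Finset.sum_mul]
    rw [add_comm]
    congr 1
    · rw [Finset.sum_eq_single j]
      · simp
      · intro i _ hij
        simp [Pi.single_eq_of_ne hij.symm]
      · simp
    · rw [← Finset.sum_add_distrib]
      refine Finset.sum_congr rfl fun i _ => ?_
      ring

theorem totalDegree_coeff_mul_le {σ : Type*} {a b : ℕ} {p q : Polynomial (MvPolynomial σ ℝ)}
    (hp : ∀ k, (p.coeff k).totalDegree ≤ a) (hq : ∀ k, (q.coeff k).totalDegree ≤ b) (k : ℕ) :
    ((p * q).coeff k).totalDegree ≤ a + b := by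
  rw [Polynomial.coeff_mul]
  exact totalDegree_finsetSum_le fun i _ =>
    (totalDegree_mul _ _).trans (add_le_add (hp _) (hq _))

theorem totalDegree_coeff_lineHom_X_le {σ : Type*} (u : σ → ℝ) (i : σ) (k : ℕ) :
    ((lineHom u (X i)).coeff k).totalDegree ≤ 1 := by
  rw [lineHom_X]
  rcases k with _ | k
  · simp
  · rw [Polynomial.coeff_add, Polynomial.coeff_C_succ, zero_add, Polynomial.coeff_X_mul,
      Polynomial.coeff_C]
    split_ifs
    · refine (totalDegree_sub _ _).trans ?_
      simp
    · simp

theorem totalDegree_coeff_lineHom_monomial_le {m : ℕ} (u : Fin m → ℝ) (α : Fin m →₀ ℕ) (c : ℝ)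
    (k : ℕ) : ((lineHom u (monomial α c)).coeff k).totalDegree ≤ α.sum fun _ e => e := by
  induction α using Finsupp.induction generalizing k with
  | zero =>
    rw [← C_apply, lineHom_C, Polynomial.coeff_C]
    split_ifs <;> simp
  | single_add i e α hi he ih =>
    have key : ∀ (e k : ℕ),
        ((lineHom u (monomial (Finsupp.single i e) 1)).coeff k).totalDegree ≤ e := by
      intro e
      induction e with
      | zero =>
        intro k
        rw [Finsupp.single_zero, ← C_apply, lineHom_C, Polynomial.coeff_C]
        split_ifs <;> simp
      | succ e ihe =>
        intro k
        rw [Finsupp.single_add, ← one_mul (1 : ℝ), ← monomial_mul, map_mul]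
        exact totalDegree_coeff_mul_le ihe (totalDegree_coeff_lineHom_X_le u i) k
    rw [← one_mul c, ← monomial_mul, map_mul, Finsupp.sum_add_index' (by simp) (by simp),
      Finsupp.sum_single_index rfl]
    exact totalDegree_coeff_mul_le (key e) ih k

/-- Restricting to lines does not raise the degree in `x`. -/
theorem totalDegree_coeff_lineHom_le {m : ℕ} (u : Fin m → ℝ) (h : MvPolynomial (Fin m) ℝ)
    (k : ℕ) : ((lineHom u h).coeff k).totalDegree ≤ h.totalDegree := by
  conv_lhs => rw [h.as_sum]
  rw [map_sum, Polynomial.finsetSum_coeff]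
  exact totalDegree_finsetSum_le fun α hα =>
    (totalDegree_coeff_lineHom_monomial_le u α _ k).trans (le_totalDegree hα)

theorem totalDegree_eval_C_le {σ : Type*} {D : ℕ} {q : Polynomial (MvPolynomial σ ℝ)}
    (hq : ∀ k, (q.coeff k).totalDegree ≤ D) (t : ℝ) :
    (q.eval (C t)).totalDegree ≤ D := by
  rw [Polynomial.eval_eq_sum, Polynomial.sum]
  refine totalDegree_finsetSum_le fun k _ => ?_
  rw [← map_pow, mul_comm, ← smul_eq_C_mul]
  exact (totalDegree_smul_le _ _).trans (hq k)

theorem totalDegree_coeff_derivative_le {σ : Type*} {D : ℕ} {q : Polynomial (MvPolynomial σ ℝ)}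
    (hq : ∀ k, (q.coeff k).totalDegree ≤ D) (k : ℕ) :
    ((Polynomial.derivative q).coeff k).totalDegree ≤ D := by
  rw [Polynomial.coeff_derivative]
  refine (totalDegree_mul _ _).trans ?_
  have : ((k : MvPolynomial σ ℝ) + 1) = C ((k : ℝ) + 1) := by simp
  rw [this, totalDegree_C]
  exact hq _

theorem hasDerivAt_linear_eval_C {σ : Type*} (Λ : MvPolynomial σ ℝ →ₗ[ℝ] ℝ)
    (q : Polynomial (MvPolynomial σ ℝ)) (t : ℝ) :
    HasDerivAt (fun t => Λ (q.eval (C t))) (Λ ((Polynomial.derivative q).eval (C t))) t := by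
  induction q using Polynomial.induction_on' with
  | add p q hp hq =>
    simp only [map_add, Polynomial.eval_add]
    exact hp.fun_add hq
  | monomial k a =>
    have h1 : ∀ (b : MvPolynomial σ ℝ) (j : ℕ) (t : ℝ),
        Λ ((Polynomial.monomial j b).eval (C t)) = t ^ j * Λ b := by
      intro b j t
      rw [Polynomial.eval_monomial, ← map_pow, mul_comm, ← smul_eq_C_mul, map_smul, smul_eq_mul]
    rw [Polynomial.derivative_monomial]
    simp only [h1]
    have h2 : a * (k : MvPolynomial σ ℝ) = (k : ℝ) • a := by
      rw [smul_eq_C_mul, mul_comm]; simp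
    rw [h2, map_smul, smul_eq_mul]
    refine ((hasDerivAt_pow k t).mul_const (Λ a)).congr_deriv ?_
    ring

theorem add_le_of_second_deriv_nonneg {F F' F'' : ℝ → ℝ} (h1 : ∀ t, HasDerivAt F (F' t) t)
    (h2 : ∀ t, HasDerivAt F' (F'' t) t) (h3 : ∀ t, 0 ≤ F'' t) : F 0 + F' 0 ≤ F 1 := by
  have hmono : Monotone F' :=
    monotone_of_deriv_nonneg (fun t => (h2 t).differentiableAt) fun t => by
      rw [(h2 t).deriv]; exact h3 t
  obtain ⟨c, hc, hc'⟩ := exists_hasDerivAt_eq_slope F F' zero_lt_one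
    (fun t _ => (h1 t).continuousAt.continuousWithinAt) fun t _ => h1 t
  have := hmono hc.1.le
  rw [hc'] at this
  linarith

/-- Along every line the second derivative of an s.o.s-convex polynomial is a sum of squares of
polynomials in the direction vector. -/
theorem isSumSq_second_derivative_lineHom {m : ℕ} {h : MvPolynomial (Fin m) ℝ}
    (hh : IsSOSConvex h) (u : Fin m → ℝ) (t : ℝ) :
    IsSumSq ((Polynomial.derivative (Polynomial.derivative (lineHom u h))).eval (C t)) := by
  obtain ⟨r, H, hH⟩ := hh
  have hH' : ∀ i j, pderiv j (pderiv i h) = ∑ k, H k j * H k i := by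
    intro i j
    have := congrFun (congrFun hH j) i
    simpa [Matrix.mul_apply] using this
  have : (Polynomial.derivative (Polynomial.derivative (lineHom u h))).eval (C t) =
      ∑ k, (∑ i, (lineHom u (H k i)).eval (C t) * (X i - C (u i))) ^ 2 := by
    simp only [derivative_lineHom, Polynomial.derivative_mul,
      Polynomial.derivative_C, mul_zero, add_zero, hH', map_sum, map_mul,
      Polynomial.eval_finsetSum, Polynomial.eval_mul, Polynomial.eval_C]
    simp only [sq, Finset.sum_mul, Finset.mul_sum]
    conv_lhs => enter [2, i]; rw [Finset.sum_comm]
    rw [Finset.sum_comm]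
    refine Finset.sum_congr rfl fun k _ => Finset.sum_congr rfl fun i _ =>
      Finset.sum_congr rfl fun j _ => ?_
    ring
  rw [this]
  exact IsSumSq.sum_sq _ _

/-- **Jensen's inequality**: a functional that is nonnegative on sums of squares behaves on
s.o.s-convex polynomials like integration against a measure with barycentre `Λ(x)/Λ(1)`. -/
theorem IsSOSConvex.jensen {m D : ℕ} {h : MvPolynomial (Fin m) ℝ} (hh : IsSOSConvex h)
    (hD : h.totalDegree ≤ D) (Λ : MvPolynomial (Fin m) ℝ →ₗ[ℝ] ℝ)
    (hΛ : ∀ σ, IsSumSq σ → σ.totalDegree ≤ D → 0 ≤ Λ σ) (h1 : Λ 1 ≠ 0) :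
    eval (fun i => Λ (X i) / Λ 1) h * Λ 1 ≤ Λ h := by
  set u : Fin m → ℝ := fun i => Λ (X i) / Λ 1 with hu
  have ev0 : ∀ q, (lineHom u q).eval (C 0) = C (eval u q) := by
    intro q
    induction q using MvPolynomial.induction_on with
    | C a => simp
    | add p q hp hq => simp only [map_add, Polynomial.eval_add, hp, hq]
    | mul_X p j hp => simp only [map_mul, Polynomial.eval_mul, hp, lineHom_X]; simp
  have ev1 : ∀ q, (lineHom u q).eval (C 1) = q := by
    intro q
    induction q using MvPolynomial.induction_on with
    | C a => simp
    | add p q hp hq => simp only [map_add, Polynomial.eval_add, hp, hq]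
    | mul_X p j hp => simp only [map_mul, Polynomial.eval_mul, hp, lineHom_X]; simp
  have hC : ∀ a q, Λ (C a * q) = a * Λ q := fun a q => by
    rw [← smul_eq_C_mul, map_smul, smul_eq_mul]
  have hdeg := totalDegree_coeff_derivative_le (totalDegree_coeff_derivative_le fun k =>
    (totalDegree_coeff_lineHom_le u h k).trans hD)
  have key := add_le_of_second_deriv_nonneg
    (hasDerivAt_linear_eval_C Λ (lineHom u h))
    (hasDerivAt_linear_eval_C Λ (Polynomial.derivative (lineHom u h)))
    fun t => hΛ _ (isSumSq_second_derivative_lineHom hh u t) (totalDegree_eval_C_le hdeg t)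
  -- the first order term vanishes because `u` is the barycentre
  have hd0 : Λ ((Polynomial.derivative (lineHom u h)).eval (C 0)) = 0 := by
    rw [derivative_lineHom, Polynomial.eval_finsetSum, map_sum]
    refine Finset.sum_eq_zero fun i _ => ?_
    rw [Polynomial.eval_mul, ev0, Polynomial.eval_C, hC, map_sub, ← mul_one (C (u i)), hC, hu]
    field_simp
    ring
  rw [hd0, ev0, ev1, ← mul_one (C _), hC, add_zero] at key
  exact key

theorem isSOSConvex_of_totalDegree_le_one {m : ℕ} {h : MvPolynomial (Fin m) ℝ}
    (hd : h.totalDegree ≤ 1) : IsSOSConvex h := by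
  refine ⟨0, 0, ?_⟩
  ext1 i j
  rw [Matrix.of_apply, Matrix.mul_apply, Finset.univ_eq_empty, Finset.sum_empty, h.as_sum,
    map_sum, map_sum]
  refine Finset.sum_eq_zero fun α hα => ?_
  rw [pderiv_monomial, pderiv_monomial]
  have hα1 : α.degree ≤ 1 := (le_totalDegree hα).trans hd
  have key : α j = 0 ∨ (α - Finsupp.single j 1 : Fin m →₀ ℕ) i = 0 := by
    rw [or_iff_not_imp_left]
    intro hj
    have h1 : Finsupp.single j 1 ≤ α :=
      Finsupp.single_le_iff.2 (Nat.one_le_iff_ne_zero.2 hj)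
    have h2 := congrArg Finsupp.degree (tsub_add_cancel_of_le h1)
    rw [map_add, Finsupp.degree_single] at h2
    rw [(Finsupp.degree_eq_zero_iff (α - Finsupp.single j 1)).1 (by omega)]
    rfl
  rcases key with h0 | h0 <;> simp [h0]

/-! ### Linear duality over a cone with an order unit -/

/-- **Strong conic duality.** If `g` is an order unit for the cone `W` and some functional `L₀`
that is nonnegative on `W` has `L₀ g = 1`, then the linear program `min {L f : L ≥ 0 on W, L g = 1}`
attains its minimum, and the minimum is `sup {ρ : f - ρ g ∈ W}`. -/
theorem exists_dual_optimum {E : Type*} [AddCommGroup E] [Module ℝ E] (W : PointedCone ℝ E)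
    (f g : E) (hg : ∀ y : E, ∃ t : ℝ, t • g + y ∈ W) (L₀ : E →ₗ[ℝ] ℝ) (h₀ : ∀ x ∈ W, 0 ≤ L₀ x)
    (h₀g : L₀ g = 1) :
    ∃ L : E →ₗ[ℝ] ℝ, (∀ x ∈ W, 0 ≤ L x) ∧ L g = 1 ∧ IsLUB {ρ : ℝ | f - ρ • g ∈ W} (L f) := by
  set A : Set ℝ := {ρ : ℝ | f - ρ • g ∈ W} with hA
  have weak : ∀ L : E →ₗ[ℝ] ℝ, (∀ x ∈ W, 0 ≤ L x) → L g = 1 → L f ∈ upperBounds A := by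
    intro L hL hLg ρ hρ
    have := hL _ hρ
    rw [map_sub, map_smul, hLg, smul_eq_mul, mul_one] at this
    linarith
  have hne : A.Nonempty := by
    obtain ⟨t, ht⟩ := hg f
    refine ⟨-t, ?_⟩
    change f - -t • g ∈ W
    rwa [neg_smul, sub_neg_eq_add, add_comm]
  have hlub : IsLUB A (sSup A) := isLUB_csSup hne ⟨_, weak L₀ h₀ h₀g⟩
  set r := sSup A
  -- adjoining `r g - f` to `W` forces the extended functional to be optimal
  let W' : PointedCone ℝ E :=
    W ⊔ Submodule.span _ {r • g - f}
  have hW' : ∀ x, x ∈ W' ↔ ∃ w ∈ W, ∃ t : ℝ, 0 ≤ t ∧ x = w + t • (r • g - f) := by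
    intro x
    simp only [W', Submodule.mem_sup, Submodule.mem_span_singleton]
    constructor
    · rintro ⟨w, hw, _, ⟨t, rfl⟩, rfl⟩
      exact ⟨w, hw, t, t.2, rfl⟩
    · rintro ⟨w, hw, t, ht, rfl⟩
      exact ⟨w, hw, _, ⟨⟨t, ht⟩, rfl⟩, rfl⟩
  have hg0 : g ≠ 0 := by
    rintro rfl
    simp at h₀g
  obtain ⟨L, hLg, hL⟩ := riesz_extension W' (LinearPMap.mkSpanSingleton g (1 : ℝ) hg0)
    (by
      rintro ⟨x, hx⟩ hxW
      obtain ⟨a, rfl⟩ := Submodule.mem_span_singleton.1 hx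
      rw [show LinearPMap.mkSpanSingleton g (1 : ℝ) hg0 ⟨a • g, hx⟩ = a • (1 : ℝ) from
        LinearPMap.mkSpanSingleton'_apply _ _ _ _ _]
      obtain ⟨w, hw, t, ht, hwt⟩ := (hW' _).1 hxW
      change a • g = _ at hwt
      rw [smul_eq_mul, mul_one]
      rcases ht.eq_or_lt with rfl | ht
      · have := h₀ w hw
        rw [zero_smul, add_zero] at hwt
        rw [← hwt, map_smul, h₀g, smul_eq_mul, mul_one] at this
        exact this
      · have hmem : r - a / t ∈ A := by
          have h1 := W.smul_mem (inv_pos.2 ht).le hw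
          change f - (r - a / t) • g ∈ W
          have h2 : w = a • g - t • (r • g - f) := by rw [hwt]; abel
          convert h1 using 1
          rw [h2]
          match_scalars <;> field_simp
          ring
        have h3 := hlub.1 hmem
        have h4 : 0 ≤ a / t := by linarith
        by_contra hneg
        exact absurd (div_neg_of_neg_of_pos (not_le.1 hneg) ht) (not_lt.2 h4))
    (by
      intro y
      obtain ⟨t, ht⟩ := hg y
      exact ⟨⟨t • g, Submodule.mem_span_singleton.2 ⟨t, rfl⟩⟩, (le_sup_left : W ≤ W') ht⟩)
  have hLg1 : L g = 1 := by
    have := hLg ⟨g, Submodule.mem_span_singleton_self g⟩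
    rw [this]
    exact LinearPMap.mkSpanSingleton'_apply_self _ _ _ _
  have hLW : ∀ x ∈ W, 0 ≤ L x := fun x hx => hL x ((le_sup_left : W ≤ W') hx)
  refine ⟨L, hLW, hLg1, ?_⟩
  have h5 : 0 ≤ L (r • g - f) := hL _ ((hW' _).2 ⟨0, W.zero_mem, 1, zero_le_one, by simp⟩)
  rw [map_sub, map_smul, hLg1, smul_eq_mul, mul_one] at h5
  have : L f = r := le_antisymm (by linarith) (hlub.2 (weak L hLW hLg1))
  rwa [this]

/-! ### Polynomials nonnegative against squares on a compact set -/

theorem integral_mul_sq_nonneg_of_forall_polynomial {n : ℕ} {Y : Set (Fin n → ℝ)}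
    (hY : IsCompact Y) (ψ : (Fin n → ℝ) → ℝ) (hψ : Continuous ψ)
    (h : ∀ θ : MvPolynomial (Fin n) ℝ, 0 ≤ ∫ y in Y, ψ y * eval y θ ^ 2)
    (v : (Fin n → ℝ) → ℝ) (hv : Continuous v) : 0 ≤ ∫ y in Y, ψ y * v y ^ 2 := by
  have : CompactSpace Y := isCompact_iff_compactSpace.1 hY
  let Φ : MvPolynomial (Fin n) ℝ →ₐ[ℝ] C(Y, ℝ) :=
    aeval fun i => ⟨fun y => y.1 i, (continuous_apply i).comp continuous_subtype_val⟩
  have hΦ : ∀ θ y, Φ θ y = eval y.1 θ := by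
    intro θ y
    induction θ using MvPolynomial.induction_on with
    | C a => simp [Φ]
    | add p q hp hq => simp [hp, hq]
    | mul_X p j hp => simp [hp, Φ]
  have hsep : Φ.range.SeparatesPoints := by
    intro x y hxy
    obtain ⟨i, hi⟩ : ∃ i, x.1 i ≠ y.1 i := by
      by_contra hcon
      push Not at hcon
      exact hxy (Subtype.ext (funext hcon))
    exact ⟨_, ⟨Φ (X i), ⟨X i, rfl⟩, rfl⟩, by simpa [hΦ] using hi⟩
  have happ : ∀ k : ℕ, ∃ θ : MvPolynomial (Fin n) ℝ, ∀ y ∈ Y,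
      |eval y θ - v y| < 1 / ((k : ℝ) + 1) := by
    intro k
    obtain ⟨⟨_, ⟨θ, rfl⟩⟩, hθ⟩ :=
      ContinuousMap.exists_mem_subalgebra_near_continuous_of_separatesPoints Φ.range hsep
        (fun y => v y.1) (by fun_prop) (1 / ((k : ℝ) + 1)) Nat.one_div_pos_of_nat
    refine ⟨θ, fun y hy => ?_⟩
    have := hθ ⟨y, hy⟩
    simpa [hΦ] using this
  choose θ hθ using happ
  have hlim : Filter.Tendsto (fun k => ∫ y in Y, ψ y * eval y (θ k) ^ 2) Filter.atTop
      (nhds (∫ y in Y, ψ y * v y ^ 2)) := by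
    refine tendsto_integral_of_dominated_convergence (fun y => |ψ y| * (|v y| + 1) ^ 2) ?_ ?_ ?_ ?_
    · intro k
      exact (hψ.mul ((MvPolynomial.continuous_eval _).pow 2)).aestronglyMeasurable
    · exact (Continuous.continuousOn (by fun_prop)).integrableOn_compact hY
    · intro k
      refine (ae_restrict_iff' hY.measurableSet).2 (.of_forall fun y hy => ?_)
      rw [Real.norm_eq_abs, abs_mul, abs_pow]
      have h1 := hθ k y hy
      have h2 : (1 : ℝ) / ((k : ℝ) + 1) ≤ 1 := by
        rw [div_le_one (by positivity)]
        linarith [(Nat.cast_nonneg k : (0 : ℝ) ≤ k)]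
      have h3 : |eval y (θ k)| ≤ |v y| + 1 := by
        have := abs_sub_abs_le_abs_sub (eval y (θ k)) (v y)
        linarith
      gcongr
    · refine (ae_restrict_iff' hY.measurableSet).2 (.of_forall fun y hy => ?_)
      have h1 : Filter.Tendsto (fun k => eval y (θ k)) Filter.atTop (nhds (v y)) := by
        rw [tendsto_iff_dist_tendsto_zero]
        refine squeeze_zero (fun _ => dist_nonneg) (fun k => ?_) tendsto_one_div_add_atTop_nhds_zero_nat
        rw [Real.dist_eq]
        exact (hθ k y hy).le
      exact (h1.pow 2).const_mul _
  exact ge_of_tendsto' hlim fun k => h _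

/-- On a compact set in which every point carries mass, a continuous function that is nonnegative
on average against all squares of polynomials is nonnegative: test against `√(ψ⁻)`. -/
theorem nonneg_of_integral_mul_sq_polynomial_nonneg {n : ℕ} {Y : Set (Fin n → ℝ)}
    (hY : IsCompact Y) (hsupp : Y ⊆ (volume.restrict Y).support) (ψ : (Fin n → ℝ) → ℝ)
    (hψ : Continuous ψ) (h : ∀ θ : MvPolynomial (Fin n) ℝ, 0 ≤ ∫ y in Y, ψ y * eval y θ ^ 2) :
    ∀ y ∈ Y, 0 ≤ ψ y := by
  have h1 := integral_mul_sq_nonneg_of_forall_polynomial hY ψ hψ h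
    (fun y => √(max (-ψ y) 0)) (by fun_prop)
  have h2 : ∀ y, ψ y * √(max (-ψ y) 0) ^ 2 = -(max (-ψ y) 0) ^ 2 := by
    intro y
    rw [Real.sq_sqrt (le_max_right _ _)]
    rcases le_total (-ψ y) 0 with h | h
    · simp [max_eq_right h]
    · rw [max_eq_left h]; ring
  simp only [h2] at h1
  rw [integral_neg] at h1
  have hint : IntegrableOn (fun y => (max (-ψ y) 0) ^ 2) Y :=
    (Continuous.continuousOn (by fun_prop)).integrableOn_compact hY
  have h3 : ∫ y in Y, (max (-ψ y) 0) ^ 2 = 0 :=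
    le_antisymm (by linarith) (integral_nonneg fun y => by positivity)
  rw [integral_eq_zero_iff_of_nonneg (fun y => by positivity) hint] at h3
  intro y hy
  by_contra hneg
  have hpos := (Measure.mem_support_iff_forall _).1 (hsupp hy) {z | ψ z < 0}
    ((isOpen_lt hψ continuous_const).mem_nhds (not_le.1 hneg))
  refine hpos.ne' (measure_mono_null ?_ h3)
  intro z hz hz0
  have hz' : ψ z < 0 := hz
  have hz0' : (max (-ψ z) 0) ^ 2 = 0 := hz0
  rw [max_eq_left (by linarith)] at hz0'
  have := pow_eq_zero_iff (two_ne_zero) |>.1 hz0'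
  linarith

/-! ### The truncated quadratic module -/

theorem IsSumSq.smul_of_nonneg {σ : Type*} {p : MvPolynomial σ ℝ} (hp : IsSumSq p) {c : ℝ}
    (hc : 0 ≤ c) : IsSumSq (c • p) := by
  have : c • p = C (√c) * C (√c) * p := by
    rw [← map_mul, Real.mul_self_sqrt hc, smul_eq_C_mul]
  rw [this]
  exact (IsSumSq.mul_self _).mul hp

theorem eval_nonneg_of_isSumSq {σ : Type*} {p : MvPolynomial σ ℝ} (hp : IsSumSq p)
    (x : σ → ℝ) : 0 ≤ eval x p := by
  induction hp with
  | zero => simp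
  | sq_add a _ ih =>
    rw [map_add, map_mul]
    exact add_nonneg (mul_self_nonneg _) ih

theorem exists_le_degree_eq {ι : Type*} (α : ι →₀ ℕ) (a : ℕ) (ha : a ≤ α.degree) :
    ∃ β, β ≤ α ∧ β.degree = a := by
  induction a with
  | zero => exact ⟨0, zero_le, by simp⟩
  | succ a ih =>
    obtain ⟨β, hβ, hβa⟩ := ih (by omega)
    obtain ⟨i, hi⟩ : ∃ i, β i < α i := by
      by_contra hcon
      push Not at hcon
      have : β = α := le_antisymm hβ hcon
      subst this
      omega
    refine ⟨β + Finsupp.single i 1, ?_, by simp [hβa]⟩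
    intro j
    by_cases hj : i = j
    · subst hj; simpa using hi
    · simpa [Finsupp.single_apply, hj] using hβ j

theorem totalDegree_monomial_sq_le {σ : Type*} (β : σ →₀ ℕ) :
    ((monomial β (1 : ℝ)) ^ 2).totalDegree ≤ 2 * β.degree := by
  refine (totalDegree_pow _ _).trans ?_
  rw [totalDegree_monomial _ one_ne_zero]
  exact le_rfl

namespace FSIPP

variable {m n s : ℕ} (P : FSIPP m n s) {R gs : ℝ}

theorem zero_mem_quadModule : (0 : MvPolynomial (Fin m) ℝ) ∈ P.quadModule R gs :=
  ⟨0, 0, 0, .zero, .zero, .zero, by simp, by simp, by simp, by simp⟩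

theorem add_mem_quadModule {a b : MvPolynomial (Fin m) ℝ} (ha : a ∈ P.quadModule R gs)
    (hb : b ∈ P.quadModule R gs) : a + b ∈ P.quadModule R gs := by
  obtain ⟨a₀, a₁, a₂, h₀, h₁, h₂, d₀, d₁, d₂, rfl⟩ := ha
  obtain ⟨b₀, b₁, b₂, k₀, k₁, k₂, e₀, e₁, e₂, rfl⟩ := hb
  refine ⟨a₀ + b₀, a₁ + b₁, a₂ + b₂, h₀.add k₀, h₁.add k₁, h₂.add k₂,
    (totalDegree_add _ _).trans (max_le d₀ e₀), ?_, ?_, by ring⟩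
  · rw [add_mul]; exact (totalDegree_add _ _).trans (max_le d₁ e₁)
  · rw [add_mul]; exact (totalDegree_add _ _).trans (max_le d₂ e₂)

theorem smul_mem_quadModule {a : MvPolynomial (Fin m) ℝ} (ha : a ∈ P.quadModule R gs) {c : ℝ}
    (hc : 0 ≤ c) : c • a ∈ P.quadModule R gs := by
  obtain ⟨a₀, a₁, a₂, h₀, h₁, h₂, d₀, d₁, d₂, rfl⟩ := ha
  refine ⟨c • a₀, c • a₁, c • a₂, h₀.smul_of_nonneg hc, h₁.smul_of_nonneg hc,
    h₂.smul_of_nonneg hc, (totalDegree_smul_le _ _).trans d₀, ?_, ?_, by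
      simp only [smul_add, smul_mul_assoc]⟩
  · rw [smul_mul_assoc]; exact (totalDegree_smul_le _ _).trans d₁
  · rw [smul_mul_assoc]; exact (totalDegree_smul_le _ _).trans d₂

theorem isSumSq_mem_quadModule {σ : MvPolynomial (Fin m) ℝ} (hσ : IsSumSq σ)
    (hd : σ.totalDegree ≤ 2 * P.d) : σ ∈ P.quadModule R gs :=
  ⟨σ, 0, 0, hσ, .zero, .zero, hd, by simp, by simp, by simp⟩

theorem C_mem_quadModule {c : ℝ} (hc : 0 ≤ c) :
    (C c : MvPolynomial (Fin m) ℝ) ∈ P.quadModule R gs := by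
  refine P.isSumSq_mem_quadModule ?_ (by simp)
  have := (IsSumSq.one (R := MvPolynomial (Fin m) ℝ)).smul_of_nonneg hc
  rwa [smul_eq_C_mul, mul_one] at this

theorem g_sub_mem_quadModule : P.g - C gs ∈ P.quadModule R gs := by
  refine ⟨0, 0, 1, .zero, .zero, .one, by simp, by simp, ?_, by simp⟩
  rw [one_mul]
  refine (totalDegree_sub _ _).trans (max_le ?_ (by simp))
  exact (mem_restrictTotalDegree _ _ _).1 P.g_mem

/-- The ball constraint bounds the squares of all monomials of degree at most `d`. -/
theorem exists_C_sub_monomial_sq_mem_quadModule (R gs : ℝ) (β : Fin m →₀ ℕ) (hβ : β.degree ≤ P.d) :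
    ∃ c : ℝ, C c - (monomial β (1 : ℝ)) ^ 2 ∈ P.quadModule R gs := by
  induction hk : β.degree generalizing β with
  | zero =>
    obtain rfl : β = 0 := (Finsupp.degree_eq_zero_iff _).1 hk
    refine ⟨1, ?_⟩
    rw [← C_apply, ← map_pow, one_pow, sub_self]
    exact P.zero_mem_quadModule
  | succ k ih =>
    obtain ⟨γ, hγ, hγk⟩ := exists_le_degree_eq β k (by omega)
    obtain ⟨i, hi⟩ : ∃ i, γ i < β i := by
      by_contra hcon
      push Not at hcon
      have : γ = β := le_antisymm hγ hcon
      subst this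
      omega
    have hle : γ + Finsupp.single i 1 ≤ β := by
      intro j
      by_cases hj : i = j
      · subst hj; simpa using hi
      · simpa [Finsupp.single_apply, hj] using hγ j
    obtain ⟨δ, rfl⟩ := le_iff_exists_add.1 hle
    have hδ : δ = 0 := (Finsupp.degree_eq_zero_iff _).1 (by simp at hk; omega)
    subst hδ
    obtain ⟨c, hc⟩ := ih γ (by omega) hγk
    refine ⟨R ^ 2 * c, ?_⟩
    have h1 : ((monomial γ (1 : ℝ)) ^ 2 * (C (R ^ 2) - ∑ i, X i ^ 2)) ∈ P.quadModule R gs := by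
      refine ⟨0, (monomial γ (1 : ℝ)) ^ 2, 0, .zero, (IsSquare.sq _).isSumSq, .zero, by simp,
        ?_, by simp, by simp⟩
      refine (totalDegree_mul _ _).trans ?_
      have e1 := totalDegree_monomial_sq_le γ
      have e2 : (C (R ^ 2) - ∑ i : Fin m, X i ^ 2 : MvPolynomial (Fin m) ℝ).totalDegree ≤ 2 := by
        refine (totalDegree_sub _ _).trans (max_le (by rw [totalDegree_C]; omega) ?_)
        exact totalDegree_finsetSum_le fun j _ => by simp
      omega
    have h2 : ∑ j ∈ Finset.univ.erase i, (monomial γ (1 : ℝ) * X j) ^ 2 ∈ P.quadModule R gs := by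
      refine P.isSumSq_mem_quadModule (IsSumSq.sum_sq _ _) ?_
      refine totalDegree_finsetSum_le fun j _ => (totalDegree_pow _ _).trans ?_
      have e3 := totalDegree_mul (monomial γ (1 : ℝ)) (X j)
      rw [totalDegree_monomial _ one_ne_zero, totalDegree_X] at e3
      change _ ≤ γ.degree + 1 at e3
      omega
    convert P.add_mem_quadModule (P.smul_mem_quadModule hc (sq_nonneg R))
      (P.add_mem_quadModule h1 h2) using 1
    have e4 : (monomial (γ + Finsupp.single i 1 + 0) (1 : ℝ)) = monomial γ 1 * X i := by
      rw [add_zero, ← one_mul (1 : ℝ), ← monomial_mul, one_mul]; rfl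
    rw [e4, smul_eq_C_mul, map_mul, ← Finset.add_sum_erase _ _ (Finset.mem_univ i)]
    simp only [mul_pow, ← Finset.mul_sum]
    ring

theorem exists_C_add_smul_monomial_mem_quadModule (R gs : ℝ) {α : Fin m →₀ ℕ}
    (hα : α.degree ≤ 2 * P.d) (c : ℝ) :
    ∃ N : ℝ, C N + monomial α c ∈ P.quadModule R gs := by
  obtain ⟨β, hβ, hβd⟩ := exists_le_degree_eq α (min α.degree P.d) (min_le_left _ _)
  obtain ⟨γ, rfl⟩ := le_iff_exists_add.1 hβ
  rw [map_add] at hα hβd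
  obtain ⟨b, hb⟩ := P.exists_C_sub_monomial_sq_mem_quadModule R gs β (by omega)
  obtain ⟨a, ha⟩ := P.exists_C_sub_monomial_sq_mem_quadModule R gs γ (by omega)
  -- `c/2 (b + a) ± c x^(β+γ) = c/2 ((x^β ± x^γ)² + (b - x^(2β)) + (a - x^(2γ)))`, and `ε` is the sign
  have key : ∀ ε : ℝ, ε ^ 2 = 1 → ∀ c : ℝ, 0 ≤ c →
      C (c / 2 * (b + a)) + monomial (β + γ) (ε * c) ∈ P.quadModule R gs := by
    intro ε hε c hc
    have h1 : (monomial β (1 : ℝ) + C ε * monomial γ 1) ^ 2 ∈ P.quadModule R gs := by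
      refine P.isSumSq_mem_quadModule (IsSquare.sq _).isSumSq ((totalDegree_pow _ _).trans ?_)
      have e1 : (monomial β (1 : ℝ) + C ε * monomial γ 1).totalDegree ≤ P.d := by
        refine (totalDegree_add _ _).trans (max_le ?_ ?_)
        · rw [totalDegree_monomial _ one_ne_zero]
          change β.degree ≤ _
          omega
        · rw [← smul_eq_C_mul]
          refine (totalDegree_smul_le _ _).trans ?_
          rw [totalDegree_monomial _ one_ne_zero]
          change γ.degree ≤ _
          omega
      omega
    convert P.smul_mem_quadModule (P.add_mem_quadModule h1 (P.add_mem_quadModule hb ha))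
      (div_nonneg hc two_pos.le) using 1
    have e2 : monomial (β + γ) (ε * c) = C ε * C c * (monomial β 1 * monomial γ 1) := by
      rw [monomial_mul, ← map_mul, C_mul_monomial, one_mul, mul_one]
    have e3 : (C ε : MvPolynomial (Fin m) ℝ) ^ 2 = 1 := by rw [← map_pow, hε, C_1]
    have e4 : (C c : MvPolynomial (Fin m) ℝ) = C (c / 2) + C (c / 2) := by
      rw [← map_add, add_halves]
    rw [e2, e4, smul_eq_C_mul, map_mul, map_add]
    generalize (monomial β (1 : ℝ)) = p at *
    generalize (monomial γ (1 : ℝ)) = q at *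
    linear_combination (-C (c / 2) * q ^ 2) * e3
  rcases le_total 0 c with hc | hc
  · have := key 1 (by norm_num) c hc
    rw [one_mul] at this
    exact ⟨_, this⟩
  · have := key (-1) (by norm_num) (-c) (by linarith)
    rw [neg_one_mul, neg_neg] at this
    exact ⟨_, this⟩

/-- The constant `1` is an order unit: the quadratic module is archimedean already at its
truncation degree. -/
theorem exists_C_add_mem_quadModule (R gs : ℝ) {h : MvPolynomial (Fin m) ℝ} (hh : h ∈ P.PolyX) :
    ∃ N : ℝ, 0 ≤ N ∧ C N + h ∈ P.quadModule R gs := by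
  rw [mem_restrictTotalDegree] at hh
  have h1 : ∀ α ∈ h.support, ∃ N : ℝ, C N + monomial α (coeff α h) ∈ P.quadModule R gs :=
    fun α hα => P.exists_C_add_smul_monomial_mem_quadModule R gs
      ((le_totalDegree hα).trans hh) _
  choose! N hN using h1
  have h2 : C (∑ α ∈ h.support, N α) + h ∈ P.quadModule R gs := by
    conv => enter [2, 2]; rw [h.as_sum]
    rw [map_sum, ← Finset.sum_add_distrib]
    exact Finset.sum_induction _ (· ∈ P.quadModule R gs) (fun _ _ => P.add_mem_quadModule)
      P.zero_mem_quadModule hN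
  refine ⟨max (∑ α ∈ h.support, N α) 0, le_max_right _ _, ?_⟩
  convert P.add_mem_quadModule h2 (P.C_mem_quadModule (sub_nonneg.2
    (le_max_left (∑ α ∈ h.support, N α) 0))) using 1
  rw [map_sub]
  ring

theorem exists_smul_g_add_mem_quadModule (R : ℝ) (hgs : 0 < gs) {h : MvPolynomial (Fin m) ℝ}
    (hh : h ∈ P.PolyX) : ∃ t : ℝ, t • P.g + h ∈ P.quadModule R gs := by
  obtain ⟨N, hN, hM⟩ := P.exists_C_add_mem_quadModule R gs hh
  refine ⟨N / gs, ?_⟩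
  convert P.add_mem_quadModule hM
    (P.smul_mem_quadModule P.g_sub_mem_quadModule (div_nonneg hN hgs.le)) using 1
  rw [smul_sub, smul_eq_C_mul (C gs), ← map_mul, div_mul_cancel₀ _ hgs.ne']
  ring

/-! ### Duality between the two relaxations -/

theorem applyX_mem (L : Module.Dual ℝ P.PolyX) : P.applyX L ∈ P.PolyY :=
  Submodule.sum_mem _ fun _ _ => Submodule.smul_mem _ _ (P.coeff_mem _)

theorem applyY_mem (H : Module.Dual ℝ P.PolyY) : P.applyY H ∈ P.PolyX := by
  refine Submodule.sum_mem _ fun α hα => ?_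
  have := Submodule.smul_mem _ (H ⟨coeff α P.p, P.coeff_mem α⟩) (P.monomial_mem hα)
  rwa [smul_monomial, smul_eq_mul, mul_one] at this

/-- `ℒ(ℋ(p)) = ℋ(ℒ(p))`. -/
theorem apply_applyY (L : Module.Dual ℝ P.PolyX) (H : Module.Dual ℝ P.PolyY) :
    L ⟨P.applyY H, P.applyY_mem H⟩ = H ⟨P.applyX L, P.applyX_mem L⟩ := by
  have h1 : (⟨P.applyY H, P.applyY_mem H⟩ : P.PolyX) = ∑ α ∈ P.p.support.attach,
      H ⟨coeff α.1 P.p, P.coeff_mem α⟩ • ⟨monomial α.1 1, P.monomial_mem α.2⟩ := by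
    ext1
    change P.applyY H = _
    rw [applyY, ← Finset.sum_attach]
    simp [smul_monomial]
  have h2 : (⟨P.applyX L, P.applyX_mem L⟩ : P.PolyY) = ∑ α ∈ P.p.support.attach,
      L ⟨monomial α.1 1, P.monomial_mem α.2⟩ • ⟨coeff α.1 P.p, P.coeff_mem α⟩ := by
    ext1
    change P.applyX L = _
    rw [applyX]
    simp
  rw [h1, h2, map_sum, map_sum]
  refine Finset.sum_congr rfl fun α _ => ?_
  rw [map_smul, map_smul, smul_eq_mul, smul_eq_mul, mul_comm]

theorem applyY_add (H H' : Module.Dual ℝ P.PolyY) :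
    P.applyY (H + H') = P.applyY H + P.applyY H' := by
  simp [applyY, Finset.sum_add_distrib]

theorem applyY_smul (c : ℝ) (H : Module.Dual ℝ P.PolyY) :
    P.applyY (c • H) = c • P.applyY H := by
  simp [applyY, Finset.smul_sum, smul_monomial]

theorem applyY_zero : P.applyY 0 = 0 := by
  simp [applyY]

/-- The polynomials certified to be nonnegative by the relaxation of order `k`; the program
`(P_k)` maximizes `ρ` subject to `f - ρ g` lying in this cone. -/
noncomputable def certCone (R gs : ℝ) (k : ℕ) : PointedCone ℝ P.PolyX where
  carrier := {h | ∃ (H : Module.Dual ℝ P.PolyY) (η : Fin s → ℝ),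
    (h : MvPolynomial (Fin m) ℝ) + P.applyY H + ∑ j, C (η j) * P.φ j ∈ P.quadModule R gs ∧
    (∀ ψ : P.PolyY, (ψ : MvPolynomial (Fin n) ℝ) ∈ P.outerCone k → 0 ≤ H ψ) ∧ ∀ j, 0 ≤ η j}
  zero_mem' := ⟨0, 0, by simpa [applyY_zero] using P.zero_mem_quadModule, by simp, by simp⟩
  add_mem' := by
    rintro a b ⟨H, η, h1, h2, h3⟩ ⟨H', η', h1', h2', h3'⟩
    refine ⟨H + H', η + η', ?_, fun ψ hψ => add_nonneg (h2 ψ hψ) (h2' ψ hψ),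
      fun j => add_nonneg (h3 j) (h3' j)⟩
    convert P.add_mem_quadModule h1 h1' using 1
    simp only [applyY_add, Pi.add_apply, map_add, add_mul, Finset.sum_add_distrib,
      Submodule.coe_add]
    ring
  smul_mem' := by
    rintro ⟨c, hc⟩ a ⟨H, η, h1, h2, h3⟩
    refine ⟨c • H, c • η, ?_, fun ψ hψ => mul_nonneg hc (h2 ψ hψ),
      fun j => mul_nonneg hc (h3 j)⟩
    convert P.smul_mem_quadModule h1 hc using 1
    rw [applyY_smul, smul_add, smul_add, Finset.smul_sum]
    simp only [Pi.smul_apply, smul_eq_mul, map_mul, smul_eq_C_mul, mul_assoc]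
    congr 2
    change c • (a : MvPolynomial (Fin m) ℝ) = _
    rw [smul_eq_C_mul]

variable {P}

theorem mem_certCone {k : ℕ} {h : P.PolyX} : h ∈ P.certCone R gs k ↔
    ∃ (H : Module.Dual ℝ P.PolyY) (η : Fin s → ℝ),
    (h : MvPolynomial (Fin m) ℝ) + P.applyY H + ∑ j, C (η j) * P.φ j ∈ P.quadModule R gs ∧
    (∀ ψ : P.PolyY, (ψ : MvPolynomial (Fin n) ℝ) ∈ P.outerCone k → 0 ≤ H ψ) ∧ ∀ j, 0 ≤ η j :=
  Iff.rfl

theorem certCone_mono : Monotone (P.certCone R gs) := by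
  rintro k l hkl h ⟨H, η, h1, h2, h3⟩
  exact ⟨H, η, h1, fun ψ hψ => h2 ψ ⟨hψ.1, fun σ hσ hd => hψ.2 σ hσ (by omega)⟩, h3⟩

theorem quadModule_subset_certCone {k : ℕ} {h : P.PolyX}
    (hh : (h : MvPolynomial (Fin m) ℝ) ∈ P.quadModule R gs) : h ∈ P.certCone R gs k :=
  ⟨0, 0, by simpa [applyY_zero] using hh, by simp, by simp⟩

theorem integrable_eval_mul (hY : IsCompact P.Y) (ψ σ : MvPolynomial (Fin n) ℝ) :
    IntegrableOn (fun y => eval y (ψ * σ)) P.Y :=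
  (MvPolynomial.continuous_eval _).continuousOn.integrableOn_compact hY

/-- The functional `ψ ↦ ∫_Y ψ σ` on `ℝ[y]_{d_y}`. -/
noncomputable def integralFunctional (hY : IsCompact P.Y) (σ : MvPolynomial (Fin n) ℝ) :
    Module.Dual ℝ P.PolyY where
  toFun ψ := ∫ y in P.Y, eval y ((ψ : MvPolynomial (Fin n) ℝ) * σ)
  map_add' a b := by
    rw [← integral_add (integrable_eval_mul hY _ _) (integrable_eval_mul hY _ _)]
    simp [add_mul]
  map_smul' c a := by
    simp [integral_const_mul]

/-- Feasibility in `(D_k)` is nonnegativity on the cone of certificates. -/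
theorem dualFeasible_iff (hY : IsCompact P.Y) {k : ℕ} {L : Module.Dual ℝ P.PolyX} :
    P.DualFeasible R gs k L ↔
      (∀ h ∈ P.certCone R gs k, 0 ≤ L h) ∧ L ⟨P.g, P.g_mem⟩ = 1 := by
  constructor
  · rintro ⟨h1, h2, h3, h4⟩
    refine ⟨?_, h2⟩
    rintro h ⟨H, η, hM, hH, hη⟩
    let φ' : Fin s → P.PolyX := fun j => ⟨P.φ j, P.φ_mem j⟩
    let q : P.PolyX := ⟨P.applyY H, P.applyY_mem H⟩
    have hsum : ((∑ j, η j • φ' j : P.PolyX) : MvPolynomial (Fin m) ℝ) =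
        ∑ j, C (η j) * P.φ j := by
      rw [Submodule.coe_sum]
      refine Finset.sum_congr rfl fun j _ => ?_
      rw [Submodule.coe_smul, smul_eq_C_mul]
    have e2 := h1 (h + q + ∑ j, η j • φ' j) (by
      rw [Submodule.coe_add, Submodule.coe_add, hsum]
      exact hM)
    let z : P.PolyY := ⟨P.applyX L, P.applyX_mem L⟩
    have e3 := hH (-z) (by
      rw [Submodule.coe_neg]
      exact h3)
    rw [map_neg, ← apply_applyY] at e3
    have h4' : ∀ j, L (φ' j) ≤ 0 := h4
    have e4 : ∑ j, η j * L (φ' j) ≤ 0 :=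
      Finset.sum_nonpos fun j _ => mul_nonpos_iff.2 (.inl ⟨hη j, h4' j⟩)
    rw [map_add, map_add, map_sum] at e2
    simp only [map_smul, smul_eq_mul] at e2
    change 0 ≤ - L q at e3
    linarith
  · rintro ⟨h1, h2⟩
    refine ⟨fun h hh => h1 h (quadModule_subset_certCone hh), h2, ⟨?_, ?_⟩, fun j => ?_⟩
    · rw [totalDegree_neg]
      exact (mem_restrictTotalDegree _ _ _).1 (P.applyX_mem L)
    · intro σ hσ hd
      have := h1 (-⟨P.applyY (integralFunctional hY σ), P.applyY_mem _⟩)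
        ⟨integralFunctional hY σ, 0, by simpa using P.zero_mem_quadModule,
          fun ψ hψ => hψ.2 σ hσ hd, by simp⟩
      rw [map_neg, apply_applyY, ← map_neg] at this
      exact this
    · have := h1 (-⟨P.φ j, P.φ_mem j⟩) ⟨0, Pi.single j 1, by
          rw [Finset.sum_eq_single j (fun i _ hij => by simp [Pi.single_eq_of_ne hij]) (by simp)]
          simpa [applyY_zero] using P.zero_mem_quadModule, by simp, fun i => by
          by_cases hij : i = j
          · subst hij; simp
          · simp [Pi.single_eq_of_ne hij]⟩
      rw [map_neg] at this
      linarith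

theorem exists_primalFeasible_iff {k : ℕ} {ρ : ℝ} :
    (∃ H η, P.PrimalFeasible R gs k ρ H η) ↔
      (⟨P.f, P.f_mem⟩ - ρ • ⟨P.g, P.g_mem⟩ : P.PolyX) ∈ P.certCone R gs k := by
  simp [PrimalFeasible, mem_certCone, smul_eq_C_mul]

/-- Evaluating `ℒ(p)` at `y` is applying `ℒ` to `p(·, y)`. -/
theorem eval_applyX (L : Module.Dual ℝ P.PolyX) (Λ : MvPolynomial (Fin m) ℝ →ₗ[ℝ] ℝ)
    (hΛ : ∀ h : P.PolyX, Λ h = L h) (y : Fin n → ℝ) :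
    eval y (P.applyX L) = Λ (P.pAt y) := by
  have h1 : P.pAt y = ∑ α ∈ P.p.support, eval y (coeff α P.p) • monomial α (1 : ℝ) := by
    rw [pAt]
    conv_lhs => rw [P.p.as_sum]
    rw [map_sum]
    simp only [map_monomial, smul_monomial, smul_eq_mul, mul_one]
  rw [h1, applyX, map_sum, map_sum, ← Finset.sum_attach P.p.support]
  refine Finset.sum_congr rfl fun α _ => ?_
  rw [smul_eval, map_smul, smul_eq_mul, mul_comm, ← hΛ]

theorem totalDegree_pAt_le (y : Fin n → ℝ) : (P.pAt y).totalDegree ≤ 2 * P.d :=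
  (Finset.sup_mono (support_map_subset _ _)).trans
    (((le_max_right _ _).trans (le_max_right _ _)).trans P.maxDeg_le)

/-! ### Strong duality of the relaxations -/

/-- Evaluation at `u`, divided by `g(u)`: the feasible point of `(D_k)` that a solution yields. -/
noncomputable def evalFunctional (P : FSIPP m n s) (u : Fin m → ℝ) : Module.Dual ℝ P.PolyX :=
  (eval u P.g)⁻¹ • ((aeval u).toLinearMap.comp P.PolyX.subtype)

theorem evalFunctional_apply (u : Fin m → ℝ) (h : P.PolyX) :
    P.evalFunctional u h = (eval u P.g)⁻¹ * eval u (h : MvPolynomial (Fin m) ℝ) := by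
  simp [evalFunctional, aeval_eq_eval]

theorem eval_nonneg_of_mem_quadModule {u : Fin m → ℝ} (hu1 : ∑ i, u i ^ 2 ≤ R ^ 2)
    (hu2 : gs ≤ eval u P.g) {h : MvPolynomial (Fin m) ℝ} (hh : h ∈ P.quadModule R gs) :
    0 ≤ eval u h := by
  obtain ⟨σ₀, σ₁, σ₂, h₀, h₁, h₂, -, -, -, rfl⟩ := hh
  simp only [map_add, map_mul, map_sub, eval_C, map_sum, map_pow, eval_X]
  have e0 := eval_nonneg_of_isSumSq h₀ u
  have e1 := mul_nonneg (eval_nonneg_of_isSumSq h₁ u) (sub_nonneg.2 hu1)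
  have e2 := mul_nonneg (eval_nonneg_of_isSumSq h₂ u) (sub_nonneg.2 hu2)
  linarith

theorem dualFeasible_evalFunctional (hY : MeasurableSet P.Y) {u : Fin m → ℝ}
    (hu : u ∈ P.feasibleSet) (hu1 : ∑ i, u i ^ 2 ≤ R ^ 2) (hgs : 0 < gs)
    (hu2 : gs ≤ eval u P.g) (k : ℕ) : P.DualFeasible R gs k (P.evalFunctional u) := by
  have hg : 0 < eval u P.g := hgs.trans_le hu2
  refine ⟨fun h hh => ?_, ?_, ⟨?_, fun σ hσ _ => ?_⟩, fun j => ?_⟩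
  · rw [evalFunctional_apply]
    exact mul_nonneg (inv_nonneg.2 hg.le) (eval_nonneg_of_mem_quadModule hu1 hu2 hh)
  · rw [evalFunctional_apply, inv_mul_cancel₀ hg.ne']
  · rw [totalDegree_neg]
    exact (mem_restrictTotalDegree _ _ _).1 (P.applyX_mem _)
  · refine setIntegral_nonneg hY fun y hy => ?_
    rw [map_mul]
    refine mul_nonneg ?_ (eval_nonneg_of_isSumSq hσ y)
    rw [map_neg, eval_applyX _ ((eval u P.g)⁻¹ • (aeval u).toLinearMap) (fun h => by
      rw [evalFunctional_apply]; simp [aeval_eq_eval])]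
    have := mul_nonpos_iff.2 (.inl ⟨inv_nonneg.2 hg.le, hu.2 y hy⟩)
    simpa [aeval_eq_eval] using this
  · rw [evalFunctional_apply]
    exact mul_nonpos_iff.2 (.inl ⟨inv_nonneg.2 hg.le, hu.1 j⟩)

theorem evalFunctional_f (u : Fin m → ℝ) :
    P.evalFunctional u ⟨P.f, P.f_mem⟩ = P.ratio u := by
  rw [evalFunctional_apply, ratio, div_eq_inv_mul]

theorem optVal_eq_ratio {u : Fin m → ℝ} (hu : u ∈ P.solutionSet) : P.optVal = P.ratio u := by
  refine IsLeast.csInf_eq ⟨⟨u, hu.1, rfl⟩, ?_⟩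
  rintro _ ⟨x, hx, rfl⟩
  exact hu.2 x hx

theorem A1.isCompact (h : P.A1) : IsCompact P.Y :=
  isCompact_Icc.of_isClosed_subset h.isClosed h.subset_cube

theorem exists_isDualMinimizer (hY : IsCompact P.Y) (hgs : 0 < gs) {k : ℕ}
    {L₀ : Module.Dual ℝ P.PolyX} (hL₀ : P.DualFeasible R gs k L₀) :
    ∃ L, P.IsDualMinimizer R gs k L ∧ P.primalVal R gs k = ((L ⟨P.f, P.f_mem⟩ : ℝ) : EReal) := by
  obtain ⟨h₀, h₀g⟩ := (dualFeasible_iff hY).1 hL₀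
  obtain ⟨L, hL, hLg, hlub⟩ := exists_dual_optimum (P.certCone R gs k) ⟨P.f, P.f_mem⟩
    ⟨P.g, P.g_mem⟩ (fun y => by
      obtain ⟨t, ht⟩ := P.exists_smul_g_add_mem_quadModule R hgs y.2
      exact ⟨t, quadModule_subset_certCone ht⟩) L₀ h₀ h₀g
  refine ⟨L, ⟨(dualFeasible_iff hY).2 ⟨hL, hLg⟩, fun L' hL' => ?_⟩, ?_⟩
  · obtain ⟨h1, h2⟩ := (dualFeasible_iff hY).1 hL'
    refine hlub.2 fun ρ hρ => ?_
    have h3 := h1 _ hρ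
    rw [map_sub, map_smul, h2, smul_eq_mul, mul_one] at h3
    linarith
  · refine IsLUB.sSup_eq ⟨?_, fun b hb => ?_⟩
    · rintro _ ⟨ρ, H, η, hf, rfl⟩
      exact EReal.coe_le_coe_iff.2 (hlub.1 (exists_primalFeasible_iff.1 ⟨H, η, hf⟩))
    · have hb' : ∀ ρ : ℝ, (⟨P.f, P.f_mem⟩ - ρ • ⟨P.g, P.g_mem⟩ : P.PolyX) ∈ P.certCone R gs k →
          (ρ : EReal) ≤ b := by
        intro ρ hρ
        obtain ⟨H, η, hf⟩ := exists_primalFeasible_iff.2 hρ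
        exact hb ⟨ρ, H, η, hf, rfl⟩
      induction b with
      | bot =>
        obtain ⟨ρ, hρ⟩ := hlub.nonempty
        exact absurd (hb' ρ hρ) (by simp)
      | top => exact le_top
      | coe b =>
        exact EReal.coe_le_coe_iff.2 (hlub.2 fun ρ hρ => EReal.coe_le_coe_iff.1 (hb' ρ hρ))

theorem IsDualMinimizer.dualVal_eq {k : ℕ} {L : Module.Dual ℝ P.PolyX}
    (hL : P.IsDualMinimizer R gs k L) :
    P.dualVal R gs k = ((L ⟨P.f, P.f_mem⟩ : ℝ) : EReal) := by
  refine IsLeast.csInf_eq ⟨⟨L, hL.1, rfl⟩, ?_⟩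
  rintro _ ⟨L', hL', rfl⟩
  exact EReal.coe_le_coe_iff.2 (hL.2 L' hL')

/-! ### Bounds on dual feasible functionals -/

theorem DualFeasible.apply_one_pos {k : ℕ} {L : Module.Dual ℝ P.PolyX}
    (hL : P.DualFeasible R gs k L) : 0 < L ⟨1, P.one_mem⟩ := by
  have h0 : 0 ≤ L ⟨1, P.one_mem⟩ := hL.1 _ (P.isSumSq_mem_quadModule .one (by simp))
  refine h0.lt_of_ne' fun h1 => ?_
  obtain ⟨N, -, hN⟩ := P.exists_C_add_mem_quadModule R gs (neg_mem P.g_mem)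
  have h2 := hL.1 (N • ⟨1, P.one_mem⟩ - ⟨P.g, P.g_mem⟩) (by
    convert hN using 1
    rw [sub_eq_add_neg, Submodule.coe_add, Submodule.coe_neg, Submodule.coe_smul, smul_eq_C_mul,
      mul_one])
  rw [map_sub, map_smul, h1, hL.2.1] at h2
  norm_num at h2

/-- The bound on the values `ℒ(h)` does not depend on the order of the relaxation. -/
theorem exists_abs_apply_le (R gs : ℝ) (h : P.PolyX) :
    ∃ N : ℝ, ∀ (k : ℕ) (L : Module.Dual ℝ P.PolyX), P.DualFeasible R gs k L →
      |L h| ≤ N * L ⟨1, P.one_mem⟩ := by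
  have key : ∀ h : P.PolyX, ∃ N : ℝ, ∀ (k : ℕ) (L : Module.Dual ℝ P.PolyX),
      P.DualFeasible R gs k L → -L h ≤ N * L ⟨1, P.one_mem⟩ := by
    intro h
    obtain ⟨N, -, hN⟩ := P.exists_C_add_mem_quadModule R gs h.2
    refine ⟨N, fun k L hL => ?_⟩
    have h2 := hL.1 (N • ⟨1, P.one_mem⟩ + h) (by
      convert hN using 1
      rw [Submodule.coe_add, Submodule.coe_smul, smul_eq_C_mul, mul_one])
    rw [map_add, map_smul, smul_eq_mul] at h2
    linarith
  obtain ⟨N, hN⟩ := key h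
  obtain ⟨N', hN'⟩ := key (-h)
  refine ⟨max N N', fun k L hL => ?_⟩
  have h1 := hN k L hL
  have h2 := hN' k L hL
  rw [map_neg, neg_neg] at h2
  have h3 := hL.apply_one_pos.le
  refine abs_le'.2 ⟨h2.trans ?_, h1.trans ?_⟩
  · exact mul_le_mul_of_nonneg_right (le_max_right _ _) h3
  · exact mul_le_mul_of_nonneg_right (le_max_left _ _) h3

theorem DualFeasible.apply_one_le {k : ℕ} {L : Module.Dual ℝ P.PolyX}
    (hL : P.DualFeasible R gs k L) (hgs : 0 < gs) : L ⟨1, P.one_mem⟩ ≤ 1 / gs := by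
  have h2 := hL.1 (⟨P.g, P.g_mem⟩ - gs • ⟨1, P.one_mem⟩) (by
    convert P.g_sub_mem_quadModule using 1
    rw [sub_eq_add_neg, Submodule.coe_add, Submodule.coe_neg, Submodule.coe_smul, smul_eq_C_mul,
      mul_one, sub_eq_add_neg])
  rw [map_sub, map_smul, hL.2.1, smul_eq_mul] at h2
  rw [le_div_iff₀ hgs]
  linarith

/-! ### Limits of dual minimizers -/

/-- A functional feasible for all the relaxations has its barycentre in the feasible set, and the
ratio `f/g` there is at most `ℒ(f)`. -/
theorem barycentre_mem_feasibleSet (hA1 : P.A1) (hA2 : P.A2)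
    (hsupp : P.Y ⊆ (volume.restrict P.Y).support) {L : Module.Dual ℝ P.PolyX}
    (hL : ∀ k, P.DualFeasible R gs k L) (Λ : MvPolynomial (Fin m) ℝ →ₗ[ℝ] ℝ)
    (hΛ : ∀ h : P.PolyX, Λ h = L h) :
    (fun i => Λ (X i) / Λ 1) ∈ P.feasibleSet ∧
      P.ratio (fun i => Λ (X i) / Λ 1) ≤ L ⟨P.f, P.f_mem⟩ := by
  set v : Fin m → ℝ := fun i => Λ (X i) / Λ 1 with hv
  have hone : Λ 1 = L ⟨1, P.one_mem⟩ := hΛ ⟨1, P.one_mem⟩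
  have hpos : 0 < Λ 1 := hone ▸ (hL 0).apply_one_pos
  have jensen : ∀ h, IsSOSConvex h → h.totalDegree ≤ 2 * P.d → eval v h * Λ 1 ≤ Λ h := by
    intro h hh hd
    refine hh.jensen hd Λ (fun σ hσ hσd => ?_) hpos.ne'
    rw [hΛ ⟨σ, (mem_restrictTotalDegree _ _ _).2 hσd⟩]
    exact (hL 0).1 _ (P.isSumSq_mem_quadModule hσ hσd)
  have deg : ∀ h : P.PolyX, (h : MvPolynomial (Fin m) ℝ).totalDegree ≤ 2 * P.d :=
    fun h => (mem_restrictTotalDegree _ _ _).1 h.2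
  have hpL : ∀ y ∈ P.Y, eval y (P.applyX L) ≤ 0 := by
    intro y hy
    have := nonneg_of_integral_mul_sq_polynomial_nonneg hA1.isCompact hsupp
      (fun y => eval y (-P.applyX L)) (MvPolynomial.continuous_eval _) (fun θ => by
        simpa [sq] using (hL (θ * θ).totalDegree).2.2.1.2 (θ * θ) (.mul_self θ) (by omega)) y hy
    rw [map_neg] at this
    linarith
  have hfeas : v ∈ P.feasibleSet := by
    refine ⟨fun j => ?_, fun y hy => ?_⟩
    · have h1 := jensen _ (hA1.sosConvex_φ j) (deg ⟨P.φ j, P.φ_mem j⟩)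
      rw [hΛ ⟨P.φ j, P.φ_mem j⟩] at h1
      exact nonpos_of_mul_nonpos_left (h1.trans ((hL 0).2.2.2 j)) hpos
    · have h1 := jensen _ (hA1.sosConvex_p y hy) (totalDegree_pAt_le y)
      rw [← eval_applyX L Λ hΛ] at h1
      exact nonpos_of_mul_nonpos_left (h1.trans (hpL y hy)) hpos
  refine ⟨hfeas, ?_⟩
  have hf := jensen _ hA2.sosConvex_f (deg ⟨P.f, P.f_mem⟩)
  have hg := jensen _ hA2.sosConvex_neg_g ((totalDegree_neg _).trans_le (deg ⟨P.g, P.g_mem⟩))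
  rw [hΛ ⟨P.f, P.f_mem⟩] at hf
  have hLg : Λ P.g = 1 := (hΛ ⟨P.g, P.g_mem⟩).trans (hL 0).2.1
  rw [map_neg, map_neg, hLg] at hg
  rw [ratio]
  rcases hA2.pos with h | ⟨hd, h⟩
  · obtain ⟨hf0, hg0⟩ := h v hfeas
    rw [div_le_iff₀ hg0]
    have : 0 < L ⟨P.f, P.f_mem⟩ := (mul_pos hf0 hpos).trans_le hf
    refine le_of_mul_le_mul_right ?_ hpos
    nlinarith
  · -- Jensen's inequality for both `g` and `-g` makes it an equality
    have hg' := jensen _ (isSOSConvex_of_totalDegree_le_one hd) (deg ⟨P.g, P.g_mem⟩)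
    rw [hLg] at hg'
    have hg1 : eval v P.g * Λ 1 = 1 := by linarith
    rw [div_le_iff₀ (h v hfeas)]
    refine le_of_mul_le_mul_right ?_ hpos
    rw [mul_assoc, hg1, mul_one]
    exact hf

theorem exists_tendsto_ultrafilter (hgs : 0 < gs) {L : ℕ → Module.Dual ℝ P.PolyX}
    (hL : ∀ k, P.DualFeasible R gs k (L k)) (U : Ultrafilter ℕ) :
    ∃ L' : Module.Dual ℝ P.PolyX, ∀ h, Filter.Tendsto (fun k => L k h) U (nhds (L' h)) := by
  have h1 : ∀ h : P.PolyX, ∃ a : ℝ, Filter.Tendsto (fun k => L k h) U (nhds a) := by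
    intro h
    obtain ⟨N, hN⟩ := exists_abs_apply_le R gs h
    have hb : ∀ k, L k h ∈ Set.Icc (-(|N| * (1 / gs))) (|N| * (1 / gs)) := by
      intro k
      rw [Set.mem_Icc, ← abs_le]
      refine (hN k _ (hL k)).trans ((mul_le_mul_of_nonneg_right (le_abs_self N)
        (hL k).apply_one_pos.le).trans ?_)
      exact mul_le_mul_of_nonneg_left ((hL k).apply_one_le hgs) (abs_nonneg N)
    obtain ⟨a, -, ha⟩ := isCompact_Icc.ultrafilter_le_nhds (U.map fun k => L k h)
      (Filter.le_principal_iff.2 (Filter.mem_map.2 (Filter.univ_mem' hb)))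
    exact ⟨a, ha⟩
  choose a ha using h1
  exact ⟨linearMapOfTendsto a L (tendsto_pi_nhds.2 ha), ha⟩

/-- Along every ultrafilter finer than `atTop`, dual minimizers converge to a functional that is
feasible for all the relaxations, so their normalized moments converge to a solution. -/
theorem exists_mem_solutionSet_tendsto (hA1 : P.A1) (hA2 : P.A2) (hgs : 0 < gs)
    {u : Fin m → ℝ} (hu : u ∈ P.solutionSet) (hu1 : ∑ i, u i ^ 2 ≤ R ^ 2)
    (hu2 : gs ≤ eval u P.g) (hsupp : P.Y ⊆ (volume.restrict P.Y).support)
    {L : ℕ → Module.Dual ℝ P.PolyX} (hL : ∀ k, P.IsDualMinimizer R gs k (L k))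
    (U : Ultrafilter ℕ) (hU : (U : Filter ℕ) ≤ Filter.atTop) :
    ∃ v ∈ P.solutionSet,
      Filter.Tendsto (fun k => L k ⟨P.f, P.f_mem⟩) U (nhds P.optVal) ∧
      ∀ hd, Filter.Tendsto (fun k => P.normMoment hd (L k)) U (nhds v) := by
  have hY := hA1.isCompact
  obtain ⟨L', hL'⟩ := exists_tendsto_ultrafilter hgs (fun k => (hL k).1) U
  have hfeas : ∀ k, P.DualFeasible R gs k L' := by
    intro k
    refine (dualFeasible_iff hY).2 ⟨fun h hh => ?_, ?_⟩
    · refine ge_of_tendsto (hL' h) (hU ?_)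
      filter_upwards [Filter.eventually_ge_atTop k] with j hj
      exact ((dualFeasible_iff hY).1 (hL j).1).1 h (certCone_mono hj hh)
    · exact tendsto_nhds_unique (hL' _) (by
        simpa only [(hL _).1.2.1] using tendsto_const_nhds)
  obtain ⟨Λ, hΛ⟩ := LinearMap.exists_extend L'
  have hΛ' : ∀ h : P.PolyX, Λ h = L' h := fun h => LinearMap.congr_fun hΛ h
  obtain ⟨hv, hvL⟩ := barycentre_mem_feasibleSet hA1 hA2 hsupp hfeas Λ hΛ'
  have hle : L' ⟨P.f, P.f_mem⟩ ≤ P.optVal := by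
    refine le_of_tendsto' (hL' _) fun k => ?_
    rw [optVal_eq_ratio hu, ← evalFunctional_f]
    exact (hL k).2 _ (dualFeasible_evalFunctional hY.measurableSet hu.1 hu1 hgs hu2 k)
  rw [optVal_eq_ratio hu] at hle
  have hsol : (fun i => Λ (X i) / Λ 1) ∈ P.solutionSet :=
    ⟨hv, fun x hx => (hvL.trans hle).trans (hu.2 x hx)⟩
  refine ⟨_, hsol, ?_, fun hd => ?_⟩
  · have : P.optVal = L' ⟨P.f, P.f_mem⟩ := by
      rw [optVal_eq_ratio hu]
      exact le_antisymm ((hu.2 _ hv).trans hvL) hle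
    rw [this]
    exact hL' _
  · refine tendsto_pi_nhds.2 fun i => ?_
    have h1 : Λ 1 = L' ⟨1, P.one_mem⟩ := hΛ' ⟨1, P.one_mem⟩
    have h2 : Λ (X i) = L' ⟨X i, P.X_mem hd i⟩ := hΛ' ⟨X i, P.X_mem hd i⟩
    rw [h1, h2]
    exact (hL' _).div (hL' _) (hfeas 0).apply_one_pos.ne'

theorem exists_subseq_tendsto_normMoment (hd : 1 ≤ P.d) {L : ℕ → Module.Dual ℝ P.PolyX}
    (hL : ∀ k, P.DualFeasible R gs k (L k)) :
    ∃ ι : ℕ → ℕ, StrictMono ι ∧ ∃ v : Fin m → ℝ,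
      Filter.Tendsto (fun i => P.normMoment hd (L (ι i))) Filter.atTop (nhds v) := by
  choose N hN using fun i => exists_abs_apply_le R gs (⟨X i, P.X_mem hd i⟩ : P.PolyX)
  have hb : ∀ k, P.normMoment hd (L k) ∈ Set.Icc (-N) N := by
    intro k
    have h : ∀ i, |P.normMoment hd (L k) i| ≤ N i := by
      intro i
      have hpos := (hL k).apply_one_pos
      rw [normMoment, abs_div, abs_of_pos hpos, div_le_iff₀ hpos]
      exact hN i k _ (hL k)
    exact ⟨fun i => (abs_le.1 (h i)).1, fun i => (abs_le.1 (h i)).2⟩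
  obtain ⟨v, -, ι, hι, hv⟩ := isCompact_Icc.tendsto_subseq hb
  exact ⟨ι, hι, v, hv⟩

end FSIPP

theorem mainTheorem1 {m n s : ℕ} (P : FSIPP m n s)
    (hA1 : P.A1) (hA2 : P.A2) (hA3 : P.A3)
    (R gs : ℝ) (hR : 0 < R) (hgs : 0 < gs)
    (hS : ∃ u ∈ P.solutionSet,
      ‖(WithLp.toLp 2 u : EuclideanSpace ℝ (Fin m))‖ < R ∧ gs < MvPolynomial.eval u P.g) :
    -- (i)
    (∀ k : ℕ, P.primalVal R gs k = P.dualVal R gs k ∧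
      P.dualVal R gs k ≤ (P.optVal : EReal) ∧
      ∃ L, P.IsDualMinimizer R gs k L ∧
        P.dualVal R gs k = ((L ⟨P.f, P.f_mem⟩ : ℝ) : EReal)) ∧
    -- (ii)
    (P.Y ⊆ (MeasureTheory.volume.restrict P.Y).support →
      Filter.Tendsto (fun k => P.primalVal R gs k) Filter.atTop (nhds (P.optVal : EReal)) ∧
      Filter.Tendsto (fun k => P.dualVal R gs k) Filter.atTop (nhds (P.optVal : EReal))) ∧
    -- (iii)
    (∀ (hd : 1 ≤ P.d) (L : ℕ → Module.Dual ℝ P.PolyX),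
      (∀ k, P.IsDualMinimizer R gs k (L k)) →
      (∀ k, 0 < L k ⟨1, P.one_mem⟩) ∧
      (∃ ι : ℕ → ℕ, StrictMono ι ∧ ∃ v : Fin m → ℝ,
        Filter.Tendsto (fun i => P.normMoment hd (L (ι i))) Filter.atTop (nhds v)) ∧
      (P.Y ⊆ (MeasureTheory.volume.restrict P.Y).support →
        (∀ (ι : ℕ → ℕ) (v : Fin m → ℝ), StrictMono ι →
          Filter.Tendsto (fun i => P.normMoment hd (L (ι i))) Filter.atTop (nhds v) →
          v ∈ P.solutionSet) ∧
        ∀ u : Fin m → ℝ, P.solutionSet = {u} →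
          Filter.Tendsto (fun k => P.normMoment hd (L k)) Filter.atTop (nhds u))) := by

  obtain ⟨u, hu, huR, hug⟩ := hS
  have hY := hA1.isCompact
  have hu1 : ∑ i, u i ^ 2 ≤ R ^ 2 := by
    rw [EuclideanSpace.norm_eq, Real.sqrt_lt' hR] at huR
    simpa using huR.le
  have hfeas := fun k =>
    FSIPP.dualFeasible_evalFunctional hY.measurableSet hu.1 hu1 hgs hug.le k
  have hmin := fun k => FSIPP.exists_isDualMinimizer hY hgs (hfeas k)
  choose L₀ hL₀ hprimal using hmin
  have heq : ∀ k, P.primalVal R gs k = P.dualVal R gs k := fun k =>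
    (hprimal k).trans (hL₀ k).dualVal_eq.symm
  refine ⟨fun k => ⟨heq k, ?_, L₀ k, hL₀ k, (hL₀ k).dualVal_eq⟩, fun hsupp => ?_,
    fun hd L hL => ⟨fun k => (hL k).1.apply_one_pos,
      FSIPP.exists_subseq_tendsto_normMoment hd fun k => (hL k).1, fun hsupp => ⟨?_, ?_⟩⟩⟩
  · rw [(hL₀ k).dualVal_eq, FSIPP.optVal_eq_ratio hu, ← FSIPP.evalFunctional_f]
    exact EReal.coe_le_coe_iff.2 ((hL₀ k).2 _ (hfeas k))
  · have hlim : Filter.Tendsto (fun k => P.dualVal R gs k) Filter.atTop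
        (nhds (P.optVal : EReal)) := by
      simp only [(hL₀ _).dualVal_eq]
      refine (continuous_coe_real_ereal.tendsto _).comp
        ((Filter.tendsto_iff_ultrafilter _ _ _).2 fun U hU => ?_)
      obtain ⟨v, -, h, -⟩ :=
        FSIPP.exists_mem_solutionSet_tendsto hA1 hA2 hgs hu hu1 hug.le hsupp hL₀ U hU
      exact h
    exact ⟨by simpa only [heq] using hlim, hlim⟩
  · intro ι v hι hv
    have hU : ((Ultrafilter.of Filter.atTop).map ι : Filter ℕ) ≤ Filter.atTop :=
      (Filter.map_mono (Ultrafilter.of_le _)).trans hι.tendsto_atTop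
    obtain ⟨w, hw, -, h⟩ := FSIPP.exists_mem_solutionSet_tendsto hA1 hA2 hgs hu hu1 hug.le hsupp
      hL ((Ultrafilter.of Filter.atTop).map ι) hU
    have h1 : Filter.Tendsto (fun i => P.normMoment hd (L (ι i)))
        (Ultrafilter.of (Filter.atTop : Filter ℕ)) (nhds w) := h hd
    rwa [tendsto_nhds_unique (hv.mono_left (Ultrafilter.of_le _)) h1]
  · intro w hw
    refine (Filter.tendsto_iff_ultrafilter _ _ _).2 fun U hU => ?_
    obtain ⟨v, hv, -, h⟩ :=
      FSIPP.exists_mem_solutionSet_tendsto hA1 hA2 hgs hu hu1 hug.le hsupp hL U hU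
    rw [hw, Set.mem_singleton_iff] at hv
    rw [← hv]
    exact h hd
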